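/- **Second-order methods.** Let $d\ge 0$ be an integer and $x_0\in\mathbb R^d$. An oracle for a function $f$ consists of a noise distribution $P$ and maps $g(x,\xi)\in\mathbb R^d$ and $H(x,\xi)$ (a symmetric $d\times d$ matrix); the query at $x_t$ returns $g_t=g(x_t,\xi_t)$ and $H_t=H(x_t,\xi_t)$, with $\xi_0,\xi_1,\dots$ independent of law $P$. A (deterministic) second-order method generates $x_1,x_2,\dots$ as follows: at step $t$, as a function of $x_0$ and the answers $(g_i,H_i)_{i\le t}$ only, it chooses $a_1,a_2,b_1,b_2\in\mathbb R$, an exact minimizer $$h_{t+1}\in\operatorname{argmin}_{h}\ \bigl\{a_1\langle g_t,h\rangle+a_2\langle H_th,h\rangle+b_1\|h\|^2+b_2\|h\|^3\bigr\},$$ and a point $x_{t+1}\in x_0+\operatorname{span}\{h_1,\dots,h_{t+1}\}$. The method may be tuned to $d$, to the horizon $T$ and to the parameters $L_1,L_2,\sigma_1,\sigma_2,R$ below. **Setting.** For parameters $L_1,L_2,\sigma_1,\sigma_2>0$ and $R\ge0$, consider all dimensions $d$, all convex $f\in C^2(\mathbb R^d)$ with $L_1$-Lipschitz gradient and $L_2$-Lipschitz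 Hessian (in operator norm), all $x_0$, all minimizers $x^*$ of $f$ with $\|x_0-x^*\|=R$, and all oracles such that for every $x$ $$\mathbb E[g(x,\xi)]=\nabla f(x),\qquad \mathbb E\|g(x,\xi)-\nabla f(x)\|^2\le\sigma_1^2,$$ and such that one of the following conditions on the Hessian holds: (A) (stochastic Hessian) $\mathbb E\|H(x,\xi)-\nabla^2 f(x)\|^2\le\sigma_2^2$ for every $x$; (B) (inexact Hessian) $H(x,\xi)=H(x)$ is deterministic and, almost surely, $\|(H(x_{t-1})-\nabla^2f(x_{t-1}))(x_t-x_{t-1})\|\le\sigma_2\|x_t-x_{t-1}\|$ for $t=1,\dots,T$. **Theorem.** There is an absolute constant $K>0$ with the following property. Let $\mathcal M$ be a second-order method, $C>0$, and let $\Xi_1,\Xi_2,\Xi_3$ be positive functions of $T\ge 1$. Suppose that in setting (A), or that in setting (B), $\mathcal M$ guarantees, for all $T\ge1$ and all parameters, dimensions, functions, starting points and oracles as above, $$\min_{0\le t\le T}\mathbb E\,[f(x_t)-f(x^*)]\ \le\ C\max\left\{\frac{\sigma_1R}{\Xi_1(T)},\ \frac{\sigma_2R^2}{\Xi_2(T)},\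 \frac{L_2R^3}{\Xi_3(T)}\right\}.$$ Then for all $T\ge1$ $$\Xi_1(T)\le K\,C\,\sqrt T,\qquad \Xi_2(T)\le K\,C\,T^2,\qquad \Xi_3(T)\le K\,C\,T^{7/2}.$$ -/

import Mathlib

open MeasureTheory Set

noncomputable section

namespace SecondOrderLowerBound

/-- The Euclidean space `ℝ^d`. -/
abbrev E (d : ℕ) := EuclideanSpace ℝ (Fin d)

/-- Linear operators on `ℝ^d`, with the operator (spectral) norm. -/
abbrev Op (d : ℕ) := E d →L[ℝ] E d

/-- The Hessian of `f` at `x`, as a linear operator. -/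
def hessian {d : ℕ} (f : E d → ℝ) (x : E d) : Op d := fderiv ℝ (gradient f) x

/-- `f` is convex and `C²` on `ℝ^d`, its gradient is `L₁`-Lipschitz and its Hessian is
`L₂`-Lipschitz. -/
structure IsSmoothConvex {d : ℕ} (f : E d → ℝ) (L₁ L₂ : ℝ) : Prop where
  convex : ConvexOn ℝ univ f
  contDiff : ContDiff ℝ 2 f
  lipschitz_gradient : ∀ x y, ‖gradient f x - gradient f y‖ ≤ L₁ * ‖x - y‖
  lipschitz_hessian : ∀ x y, ‖hessian f x - hessian f y‖ ≤ L₂ * ‖x - y‖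

/-- What the oracle returns at a query point: a gradient estimate and a Hessian estimate. -/
abbrev Answer (d : ℕ) := E d × Op d

/-- The regularized second-order model
`h ↦ a₁ ⟨g, h⟩ + a₂ ⟨H h, h⟩ + b₁ ‖h‖² + b₂ ‖h‖³`. -/
def model {d : ℕ} (a₁ a₂ b₁ b₂ : ℝ) (r : Answer d) (h : E d) : ℝ :=
  a₁ * inner ℝ r.1 h + a₂ * inner ℝ (r.2 h) h + b₁ * ‖h‖ ^ 2 + b₂ * ‖h‖ ^ 3

/-- The first `j + 1` of the answers `r 0, …, r t`. -/
def firstAnswers {d t : ℕ} (r : Fin (t + 1) → Answer d) (j : Fin (t + 1)) :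
    Fin (j.val + 1) → Answer d :=
  fun i => r (Fin.castLE (Nat.succ_le_of_lt j.isLt) i)

/-- A deterministic second-order method on `ℝ^d`. At step `t` it knows the starting point `x₀` and
the oracle answers `r 0, …, r t` received at the points `x₀, …, x_t`. From these it chooses the
coefficients of a regularized model built from the last answer `r t`, an exact minimizer
`dir` (this is `h_{t+1}`) of that model, and the next point `next` (this is `x_{t+1}`) in
`x₀ + span {h_1, …, h_{t+1}}`. -/
structure SecondOrderMethod (d : ℕ) where
  a₁ : (t : ℕ) → E d → (Fin (t + 1) → Answer d) → ℝ
  a₂ : (t : ℕ) → E d → (Fin (t + 1) → Answer d) → ℝ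
  b₁ : (t : ℕ) → E d → (Fin (t + 1) → Answer d) → ℝ
  b₂ : (t : ℕ) → E d → (Fin (t + 1) → Answer d) → ℝ
  dir : (t : ℕ) → E d → (Fin (t + 1) → Answer d) → E d
  next : (t : ℕ) → E d → (Fin (t + 1) → Answer d) → E d
  dir_isMin : ∀ t x₀ r, IsMinOn
    (model (a₁ t x₀ r) (a₂ t x₀ r) (b₁ t x₀ r) (b₂ t x₀ r) (r (Fin.last t))) univ (dir t x₀ r)
  next_mem : ∀ t x₀ r, next t x₀ r - x₀ ∈ Submodule.span ℝ
    (range fun j : Fin (t + 1) => dir j.val x₀ (firstAnswers r j))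

/-- The run of a method from `x₀`, where `resp t x` is the answer to the query of the point `x` at
step `t`: the point `x_t` together with the answers received at `x₀, …, x_{t-1}`. -/
def SecondOrderMethod.run {d : ℕ} (M : SecondOrderMethod d) (x₀ : E d)
    (resp : ℕ → E d → Answer d) : (t : ℕ) → E d × (Fin t → Answer d)
  | 0 => (x₀, Fin.elim0)
  | t + 1 =>
    let s := M.run x₀ resp t
    let r : Fin (t + 1) → Answer d := Fin.snoc (α := fun _ => Answer d) s.2 (resp t s.1)
    (M.next t x₀ r, r)

/-- The point `x_t` produced with the stochastic oracle `(g, H)` when the noise at step `s` is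
`ξ s`. -/
def SecondOrderMethod.iterate {d : ℕ} (M : SecondOrderMethod d) (x₀ : E d) {Ω : Type}
    (g : E d → Ω → E d) (H : E d → Ω → Op d) (t : ℕ) (ξ : ℕ → Ω) : E d :=
  (M.run x₀ (fun s x => (g x (ξ s), H x (ξ s))) t).1

/-- `g` is an unbiased stochastic gradient of `f` with variance at most `σ₁²`. -/
structure IsStochasticGradient {d : ℕ} (f : E d → ℝ) {Ω : Type} [MeasurableSpace Ω]
    (P : Measure Ω) (g : E d → Ω → E d) (σ₁ : ℝ) : Prop where
  measurable : Measurable (Function.uncurry g)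
  integrable : ∀ x, Integrable (g x) P
  unbiased : ∀ x, ∫ ω, g x ω ∂P = gradient f x
  integrable_sq : ∀ x, Integrable (fun ω => ‖g x ω - gradient f x‖ ^ 2) P
  variance_le : ∀ x, ∫ ω, ‖g x ω - gradient f x‖ ^ 2 ∂P ≤ σ₁ ^ 2

/-- `H` is a (symmetric, possibly biased) stochastic Hessian of `f` with mean squared error at most
`σ₂²`. -/
structure IsStochasticHessian {d : ℕ} (f : E d → ℝ) {Ω : Type} [MeasurableSpace Ω]
    (P : Measure Ω) (H : E d → Ω → Op d) (σ₂ : ℝ) : Prop where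
  measurable : Measurable (Function.uncurry H)
  symmetric : ∀ x ω, (H x ω).IsSymmetric
  integrable_sq : ∀ x, Integrable (fun ω => ‖H x ω - hessian f x‖ ^ 2) P
  variance_le : ∀ x, ∫ ω, ‖H x ω - hessian f x‖ ^ 2 ∂P ≤ σ₂ ^ 2

/-- The parameters of a problem class: Lipschitz constants, noise levels, distance from the
starting point to the solution. -/
structure Params where
  L₁ : ℝ
  L₂ : ℝ
  σ₁ : ℝ
  σ₂ : ℝ
  R : ℝ
  L₁_pos : 0 < L₁
  L₂_pos : 0 < L₂
  σ₁_pos : 0 < σ₁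
  σ₂_pos : 0 < σ₂

/-- A second-order method that may be tuned to the horizon `T`, to the parameters of the problem
class and to the dimension `d`. -/
abbrev MethodFamily := ℕ → Params → (d : ℕ) → SecondOrderMethod d

/-- `max {σ₁ R / Ξ₁(T), σ₂ R² / Ξ₂(T), L₂ R³ / Ξ₃(T)}`. -/
def rate (Ξ₁ Ξ₂ Ξ₃ : ℕ → ℝ) (p : Params) (T : ℕ) : ℝ :=
  max (p.σ₁ * p.R / Ξ₁ T) (max (p.σ₂ * p.R ^ 2 / Ξ₂ T) (p.L₂ * p.R ^ 3 / Ξ₃ T))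

/-- With independent oracle noise of law `P`, `min_{0 ≤ t ≤ T} 𝔼 [f(x_t) - f(x^*)] ≤ B`; the
expectation counts as infinite when the nonnegative variable `f(x_t) - f(x^*)` is not integrable. -/
def MinExpectedGapLE {d : ℕ} (M : SecondOrderMethod d) (f : E d → ℝ) (x₀ xstar : E d) {Ω : Type}
    [MeasurableSpace Ω] (P : Measure Ω) [IsProbabilityMeasure P]
    (g : E d → Ω → E d) (H : E d → Ω → Op d) (T : ℕ) (B : ℝ) : Prop :=
  ∃ t ≤ T,
    Integrable (fun ξ => f (M.iterate x₀ g H t ξ) - f xstar) (Measure.infinitePi fun _ : ℕ => P) ∧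
    ∫ ξ, (f (M.iterate x₀ g H t ξ) - f xstar) ∂(Measure.infinitePi fun _ : ℕ => P) ≤ B

/-- The method guarantees the rate, with constant `C`, for all convex functions with Lipschitz
gradient and Hessian, unbiased stochastic gradients and stochastic Hessians. -/
def EnsuresRateStochasticHessian (M : MethodFamily) (C : ℝ) (Ξ₁ Ξ₂ Ξ₃ : ℕ → ℝ) : Prop :=
  ∀ (T : ℕ), 1 ≤ T → ∀ (p : Params) (d : ℕ) (f : E d → ℝ), IsSmoothConvex f p.L₁ p.L₂ →
    ∀ (x₀ xstar : E d), IsMinOn f univ xstar → ‖x₀ - xstar‖ = p.R →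
    ∀ (Ω : Type) [MeasurableSpace Ω] (P : Measure Ω) [IsProbabilityMeasure P]
      (g : E d → Ω → E d) (H : E d → Ω → Op d),
      IsStochasticGradient f P g p.σ₁ → IsStochasticHessian f P H p.σ₂ →
      MinExpectedGapLE (M T p d) f x₀ xstar P g H T (C * rate Ξ₁ Ξ₂ Ξ₃ p T)

/-- The method guarantees the rate, with constant `C`, for all convex functions with Lipschitz
gradient and Hessian, unbiased stochastic gradients and deterministic inexact Hessians `H(x)` whose
error along each of the steps `x_t - x_{t-1}`, `t = 1, …, T`, is at most `σ₂ ‖x_t - x_{t-1}‖`. -/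
def EnsuresRateInexactHessian (M : MethodFamily) (C : ℝ) (Ξ₁ Ξ₂ Ξ₃ : ℕ → ℝ) : Prop :=
  ∀ (T : ℕ), 1 ≤ T → ∀ (p : Params) (d : ℕ) (f : E d → ℝ), IsSmoothConvex f p.L₁ p.L₂ →
    ∀ (x₀ xstar : E d), IsMinOn f univ xstar → ‖x₀ - xstar‖ = p.R →
    ∀ (Ω : Type) [MeasurableSpace Ω] (P : Measure Ω) [IsProbabilityMeasure P]
      (g : E d → Ω → E d) (H : E d → Op d),
      IsStochasticGradient f P g p.σ₁ → Measurable H → (∀ x, (H x).IsSymmetric) →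
      (∀ᵐ ξ ∂(Measure.infinitePi fun _ : ℕ => P), ∀ t < T,
        let x := fun s => (M T p d).iterate x₀ g (fun y _ => H y) s ξ
        ‖(H (x t) - hessian f (x t)) (x (t + 1) - x t)‖ ≤ p.σ₂ * ‖x (t + 1) - x t‖) →
      MinExpectedGapLE (M T p d) f x₀ xstar P g (fun y _ => H y) T (C * rate Ξ₁ Ξ₂ Ξ₃ p T)

end SecondOrderLowerBound

end

open MeasureTheory Set

noncomputable section

namespace SecondOrderLowerBound

/-! Each term of the rate is tested on its own hard instance. A method must meet its guarantee for
all parameters, and an oracle more accurate than `σ₁`, `σ₂` demand, or a function smoother than `L₂`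
demands, is still admissible. So the remaining parameters can be inflated until all three terms of
`rate` coincide, and the maximum becomes the single term under test. A deterministic Hessian oracle
with uniform error at most `σ₂` fits both settings, so one argument serves (A) and (B).

For `Ξ₂` and `Ξ₃` the instance is a chain `∑ ψ ⟨v i - v (i + 1), x⟩` of length `2T` along
orthonormal directions, with `v (2T) = 0`. At a point orthogonal to `v t, v (t + 1), …` the gradient
involves only `v 0, …, v t`. The directions can therefore be chosen adversarially, each orthogonal
to the points already produced (`exists_resisting_frame`). After `T` steps at least `T` links still
have their initial value `ψ 0`, so the gap is of order `T`, while `R` is of order `T^(3/2)`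
(`chain_gap_le_rate`). The Hessian must not reveal more than the gradient. For `Ξ₃` it is exact but
`ψ'' 0 = 0`, and `T ≲ C R³ / Ξ₃` gives `T^(7/2)`. For `Ξ₂` the function is quadratic and the oracle
answers `0`, an error of constant size, and `T ≲ C R² / Ξ₂` gives `T²`.

For `Ξ₁` the function is `‖x - s‖² / 2`, with a gradient oracle that shows `s` only with probability
`1 / (2T)`. With probability at least one half nothing about `s` is ever seen. -/

/-! ### Reduction to deterministic Hessian oracles -/

/-- In both settings the rate is guaranteed for deterministic Hessian oracles whose error is
uniformly at most `σ₂` in operator norm. -/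
theorem minExpectedGapLE_of_ensuresRate {M : MethodFamily} {C : ℝ} {Ξ₁ Ξ₂ Ξ₃ : ℕ → ℝ}
    (h : EnsuresRateStochasticHessian M C Ξ₁ Ξ₂ Ξ₃ ∨ EnsuresRateInexactHessian M C Ξ₁ Ξ₂ Ξ₃)
    {T : ℕ} (hT : 1 ≤ T) (p : Params) {d : ℕ} {f : E d → ℝ} (hf : IsSmoothConvex f p.L₁ p.L₂)
    {x₀ xstar : E d} (hmin : IsMinOn f univ xstar) (hR : ‖x₀ - xstar‖ = p.R)
    {Ω : Type} [MeasurableSpace Ω] (P : Measure Ω) [IsProbabilityMeasure P]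
    {g : E d → Ω → E d} {H : E d → Op d} (hg : IsStochasticGradient f P g p.σ₁)
    (hHm : Measurable H) (hHs : ∀ x, (H x).IsSymmetric)
    (hH : ∀ x, ‖H x - hessian f x‖ ≤ p.σ₂) :
    MinExpectedGapLE (M T p d) f x₀ xstar P g (fun y _ => H y) T (C * rate Ξ₁ Ξ₂ Ξ₃ p T) := by
  rcases h with h | h
  · refine h T hT p d f hf x₀ xstar hmin hR Ω P g _ hg
      ⟨hHm.comp measurable_fst, fun x _ => hHs x, fun x => integrable_const _, fun x => ?_⟩
    simpa using pow_le_pow_left₀ (norm_nonneg _) (hH x) 2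
  · refine h T hT p d f hf x₀ xstar hmin hR Ω P g H hg hHm hHs (.of_forall fun ξ t _ => ?_)
    exact (ContinuousLinearMap.le_opNorm _ _).trans
      (mul_le_mul_of_nonneg_right (hH _) (norm_nonneg _))

/-- The exact gradient is a stochastic gradient. -/
theorem isStochasticGradient_exact {d : ℕ} {f : E d → ℝ} {G : E d → E d}
    (hG : ∀ x, gradient f x = G x) (hGc : Continuous G) {Ω : Type} [MeasurableSpace Ω]
    (P : Measure Ω) [IsProbabilityMeasure P] (σ : ℝ) :
    IsStochasticGradient f P (fun x _ => G x) σ where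
  measurable := hGc.measurable.comp measurable_fst
  integrable _ := integrable_const _
  unbiased x := by simp [hG]
  integrable_sq _ := integrable_const _
  variance_le x := by simpa [hG] using sq_nonneg σ

/-- The points visited by a method when all answers are given by a fixed function `resp`. -/
def SecondOrderMethod.point {d : ℕ} (M : SecondOrderMethod d) (x₀ : E d)
    (resp : E d → Answer d) (t : ℕ) : E d :=
  (M.run x₀ (fun _ x => resp x) t).1

/-- Agreement is needed only along the trajectory of `resp`; by induction the other run follows the
same trajectory. This allows an oracle to be replaced by one that differs at points never queried.
-/
theorem SecondOrderMethod.run_congr {d : ℕ} (M : SecondOrderMethod d) (x₀ : E d)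
    {resp resp' : ℕ → E d → Answer d} {t : ℕ}
    (h : ∀ s < t, resp s (M.run x₀ resp s).1 = resp' s (M.run x₀ resp s).1) :
    M.run x₀ resp t = M.run x₀ resp' t := by
  induction t with
  | zero => rfl
  | succ t ih =>
    have h1 := ih fun s hs => h s (hs.trans t.lt_succ_self)
    have h2 := h t t.lt_succ_self
    simp only [SecondOrderMethod.run, h2]
    rw [h1]

/-- With a deterministic oracle the guarantee is about the gap itself. -/
theorem exists_gap_le_of_minExpectedGapLE {d : ℕ} {M : SecondOrderMethod d} {f : E d → ℝ}
    {x₀ xstar : E d} {Ω : Type} [MeasurableSpace Ω] {P : Measure Ω} [IsProbabilityMeasure P]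
    {G : E d → E d} {H : E d → Op d} {T : ℕ} {B : ℝ}
    (h : MinExpectedGapLE M f x₀ xstar P (fun x _ => G x) (fun x _ => H x) T B) :
    ∃ t ≤ T, f (M.point x₀ (fun x => (G x, H x)) t) - f xstar ≤ B := by
  obtain ⟨t, ht, -, hB⟩ := h
  exact ⟨t, ht, by simpa [SecondOrderMethod.iterate, SecondOrderMethod.point] using hB⟩

/-! ### Resisting frames -/

/-- A finite set with fewer than `d` elements admits a unit vector orthogonal to it. -/
theorem exists_unit_orthogonal {d : ℕ} (s : Finset (E d)) (hs : s.card < d) :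
    ∃ u : E d, ‖u‖ = 1 ∧ ∀ x ∈ s, inner ℝ u x = 0 := by
  have hne : (Submodule.span ℝ (s : Set (E d)))ᗮ ≠ ⊥ := by
    rw [Ne, Submodule.orthogonal_eq_bot_iff]
    intro htop
    have h1 : (s : Set (E d)).finrank ℝ ≤ s.card := finrank_span_finset_le_card s
    rw [Set.finrank, htop, finrank_top, finrank_euclideanSpace_fin] at h1
    omega
  obtain ⟨u, hu, hu0⟩ := Submodule.exists_mem_ne_zero_of_ne_bot hne
  refine ⟨(‖u‖⁻¹ : ℝ) • u, by simp [norm_smul, hu0], fun x hx => ?_⟩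
  rw [inner_smul_left, real_inner_comm,
    (Submodule.mem_orthogonal _ _).1 hu x (Submodule.subset_span hx), mul_zero]

/-- The first `N` vectors of `v` are orthonormal, the others vanish. -/
def IsFrame {d : ℕ} (v : ℕ → E d) (N : ℕ) : Prop :=
  ∀ i j, inner ℝ (v i) (v j) = if i = j ∧ i < N then (1 : ℝ) else 0

theorem IsFrame.eq_zero {d : ℕ} {v : ℕ → E d} {N : ℕ} (hv : IsFrame v N) {i : ℕ} (hi : N ≤ i) :
    v i = 0 := by
  have := hv i i
  rwa [if_neg (by omega), inner_self_eq_zero] at this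

theorem IsFrame.orthonormal {d : ℕ} {v : ℕ → E d} {N : ℕ} (hv : IsFrame v N) :
    Orthonormal ℝ fun i : Fin N => v i := by
  rw [orthonormal_iff_ite]
  intro i j
  rw [hv]
  simp [Fin.ext_iff]

/-- Bessel's inequality for a frame. -/
theorem IsFrame.sum_inner_sq_le {d : ℕ} {v : ℕ → E d} {N : ℕ} (hv : IsFrame v N) (u : E d) :
    ∑ i ∈ Finset.range N, (inner ℝ (v i) u) ^ 2 ≤ ‖u‖ ^ 2 := by
  have := hv.orthonormal.sum_inner_products_le (s := Finset.univ) u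
  rw [Finset.sum_range]
  simpa using this

theorem IsFrame.update {d : ℕ} {v : ℕ → E d} {N : ℕ} (hv : IsFrame v N) {u : E d}
    (hu : ‖u‖ = 1) (huv : ∀ i < N, inner ℝ u (v i) = 0) :
    IsFrame (Function.update v N u) (N + 1) := by
  have huv' : ∀ i, inner ℝ u (v i) = 0 := fun i => by
    rcases lt_or_ge i N with h | h
    · exact huv i h
    · rw [hv.eq_zero h, inner_zero_right]
  intro i j
  by_cases hi : i = N <;> by_cases hj : j = N
  · subst hi; subst hj; simp [hu]
  · subst hi; simp [Function.update_of_ne hj, huv', Ne.symm hj]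
  · subst hj
    rw [Function.update_of_ne hi, Function.update_self, real_inner_comm, huv']
    simp [hi]
  · rw [Function.update_of_ne hi, Function.update_of_ne hj, hv]
    congr 1
    simp only [eq_iff_iff, and_congr_right_iff]
    omega

/-- The resisting oracle: suppose the answer `resp v x` depends only on `v 0, …, v t` when `x` is
orthogonal to `v t, v (t + 1), …`. Then every method admits a frame such that its `t`-th point is
orthogonal to `v t, v (t + 1), …`. -/
theorem SecondOrderMethod.exists_resisting_frame {d : ℕ} (M : SecondOrderMethod d) (x₀ : E d)
    (resp : (ℕ → E d) → E d → Answer d) (N : ℕ) (hN : 2 * N ≤ d)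
    (hresp : ∀ v w x t, v N = 0 → w N = 0 → (∀ j ≤ t, v j = w j) →
      (∀ j, t ≤ j → inner ℝ (v j) x = 0) → (∀ j, t ≤ j → inner ℝ (w j) x = 0) →
      resp v x = resp w x) :
    ∃ v, IsFrame v N ∧ ∀ t j, t ≤ j → inner ℝ (v j) (M.point x₀ (resp v) t) = 0 := by
  suffices ∀ m ≤ N, ∃ v, IsFrame v m ∧
      ∀ t j, t ≤ j → inner ℝ (v j) (M.point x₀ (resp v) t) = 0 from this N le_rfl
  intro m hm
  induction m with
  | zero => exact ⟨0, fun i j => by simp, fun t j _ => by simp⟩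
  | succ m ih =>
    obtain ⟨v, hv, hvx⟩ := ih (by omega)
    classical
    -- The new vector must avoid `m` frame vectors and the `m + 1` points `x_0, …, x_m`: at most `2m
    -- + 1 < 2N ≤ d` vectors.
    let s : Finset (E d) := (Finset.range m).image v ∪
      (Finset.range (m + 1)).image (M.point x₀ (resp v))
    have hs : s.card < d := by
      have h1 := Finset.card_union_le ((Finset.range m).image v)
        ((Finset.range (m + 1)).image (M.point x₀ (resp v)))
      have h2 := Finset.card_image_le (s := Finset.range m) (f := v)
      have h3 := Finset.card_image_le (s := Finset.range (m + 1)) (f := M.point x₀ (resp v))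
      rw [Finset.card_range] at h2 h3
      change (_ ∪ _ : Finset (E d)).card < d
      omega
    obtain ⟨u, hu, hus⟩ := exists_unit_orthogonal s hs
    have huv : ∀ i < m, inner ℝ u (v i) = 0 := fun i hi => hus _ <| Finset.mem_union_left _ <|
      Finset.mem_image_of_mem _ (Finset.mem_range.2 hi)
    have hux : ∀ t ≤ m, inner ℝ u (M.point x₀ (resp v) t) = 0 := fun t ht =>
      hus _ <| Finset.mem_union_right _ <| Finset.mem_image_of_mem _ (Finset.mem_range.2 (by omega))
    set w := Function.update v m u with hw
    have hwF : IsFrame w (m + 1) := hv.update hu huv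
    have hwx : ∀ t ≤ m, ∀ j, t ≤ j → inner ℝ (w j) (M.point x₀ (resp v) t) = 0 := by
      intro t ht j hj
      rcases eq_or_ne j m with rfl | hjm
      · rw [hw, Function.update_self]; exact hux t ht
      · rw [hw, Function.update_of_ne hjm]; exact hvx t j hj
    -- `x_t` depends on the answers at `x_r` with `r < t ≤ m`, and these see only `v 0, …, v r`,
    -- which the change at index `m` leaves intact.
    have hpoint : ∀ t ≤ m, M.point x₀ (resp w) t = M.point x₀ (resp v) t := by
      intro t ht
      refine congrArg Prod.fst (M.run_congr x₀ fun r hr => ?_).symm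
      refine hresp _ _ _ r (hv.eq_zero (by omega)) (hwF.eq_zero hm) (fun j hj => ?_)
        (fun j => hvx r j) (hwx r (by omega))
      rw [hw, Function.update_of_ne (by omega)]
    refine ⟨w, hwF, fun t j hj => ?_⟩
    rcases le_or_gt t m with ht | ht
    · rw [hpoint t ht]; exact hwx t ht j hj
    -- Later points may move, but the frame vectors of index above `m` are still zero.
    · rw [hwF.eq_zero (by omega), inner_zero_left]

/-! ### Sums of ridge functions -/

section Ridge

variable {d : ℕ} {ψ ψ' ψ'' : ℝ → ℝ} (a : ℕ → E d) (N : ℕ)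

/-- The sum of the ridge functions `x ↦ ψ ⟨a i, x⟩`, `i < N`. -/
def ridgeSum (ψ : ℝ → ℝ) (a : ℕ → E d) (N : ℕ) (x : E d) : ℝ :=
  ∑ i ∈ Finset.range N, ψ (inner ℝ (a i) x)

/-- The gradient of a sum of ridge functions, in terms of `ψ'`. -/
def ridgeGradient (ψ' : ℝ → ℝ) (a : ℕ → E d) (N : ℕ) (x : E d) : E d :=
  ∑ i ∈ Finset.range N, ψ' (inner ℝ (a i) x) • a i

/-- The Hessian of a sum of ridge functions, in terms of `ψ''`. -/
def ridgeHessian (ψ'' : ℝ → ℝ) (a : ℕ → E d) (N : ℕ) (x : E d) : Op d :=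
  ∑ i ∈ Finset.range N, ψ'' (inner ℝ (a i) x) • (innerSL ℝ (a i)).smulRight (a i)

theorem ridgeHessian_apply (x u : E d) : ridgeHessian ψ'' a N x u =
    ∑ i ∈ Finset.range N, (ψ'' (inner ℝ (a i) x) * inner ℝ (a i) u) • a i := by
  simp [ridgeHessian, smul_smul]

theorem gradient_ridgeSum (h : ∀ z, HasDerivAt ψ (ψ' z) z) :
    gradient (ridgeSum ψ a N) = ridgeGradient ψ' a N := by
  funext x
  refine HasGradientAt.gradient (hasGradientAt_iff_hasFDerivAt.2 ?_)
  have h1 : HasFDerivAt (ridgeSum ψ a N)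
      (∑ i ∈ Finset.range N, ψ' (inner ℝ (a i) x) • innerSL ℝ (a i)) x :=
    HasFDerivAt.fun_sum fun i _ =>
      (h (inner ℝ (a i) x)).comp_hasFDerivAt x (innerSL ℝ (a i)).hasFDerivAt
  refine h1.congr_fderiv (ContinuousLinearMap.ext fun u => ?_)
  simp [ridgeGradient]

theorem hessian_ridgeSum (h : ∀ z, HasDerivAt ψ (ψ' z) z) (h' : ∀ z, HasDerivAt ψ' (ψ'' z) z) :
    hessian (ridgeSum ψ a N) = ridgeHessian ψ'' a N := by
  funext x
  rw [hessian, gradient_ridgeSum a N h]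
  refine HasFDerivAt.fderiv ?_
  have h1 : HasFDerivAt (ridgeGradient ψ' a N) (∑ i ∈ Finset.range N,
      (ψ'' (inner ℝ (a i) x) • innerSL ℝ (a i)).smulRight (a i)) x :=
    HasFDerivAt.fun_sum fun i _ =>
      ((h' (inner ℝ (a i) x)).comp_hasFDerivAt x (innerSL ℝ (a i)).hasFDerivAt).smul_const (a i)
  refine h1.congr_fderiv (ContinuousLinearMap.ext fun u => ?_)
  simp [ridgeHessian, smul_smul]

theorem ridgeHessian_isSymmetric (x : E d) : (ridgeHessian ψ'' a N x).IsSymmetric := by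
  intro u w
  simp only [ContinuousLinearMap.coe_coe, ridgeHessian_apply, sum_inner, inner_sum,
    inner_smul_left, inner_smul_right]
  refine Finset.sum_congr rfl fun i _ => ?_
  rw [real_inner_comm u (a i)]
  simp only [conj_trivial]
  ring

variable {a N} {c : ℝ}

/-- If `∑ ⟨a i, u⟩² ≤ c ‖u‖²` for all `u` and `|α i| ≤ B |⟨a i, u⟩|`, then
`‖∑ α i • a i‖ ≤ B c ‖u‖`. -/
theorem norm_sum_smul_le (hc : 0 ≤ c)
    (ha : ∀ u, ∑ i ∈ Finset.range N, (inner ℝ (a i) u) ^ 2 ≤ c * ‖u‖ ^ 2)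
    {α : ℕ → ℝ} {B : ℝ} (hB : 0 ≤ B) {u : E d} (hα : ∀ i, |α i| ≤ B * |inner ℝ (a i) u|) :
    ‖∑ i ∈ Finset.range N, α i • a i‖ ≤ B * c * ‖u‖ := by
  set w := ∑ i ∈ Finset.range N, α i • a i with hw
  -- Test the sum against itself. After Cauchy–Schwarz the bound `ha` applies to both factors, at
  -- `u` and at `w`, and `‖w‖²` cancels.
  have h1 : ‖w‖ ^ 2 = ∑ i ∈ Finset.range N, α i * inner ℝ (a i) w := by
    rw [← real_inner_self_eq_norm_sq]
    nth_rewrite 1 [hw]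
    simp [sum_inner, inner_smul_left]
  have h2 : (‖w‖ ^ 2) ^ 2 ≤ (B ^ 2 * (c * ‖u‖ ^ 2)) * (c * ‖w‖ ^ 2) := by
    refine (congrArg (· ^ 2) h1).trans_le ((Finset.sum_mul_sq_le_sq_mul_sq _ _ _).trans ?_)
    refine mul_le_mul ?_ (ha w) (Finset.sum_nonneg fun _ _ => sq_nonneg _) (by positivity)
    refine le_trans ?_ (mul_le_mul_of_nonneg_left (ha u) (sq_nonneg B))
    rw [Finset.mul_sum]
    refine Finset.sum_le_sum fun i _ => ?_
    rw [← sq_abs, ← sq_abs (inner ℝ (a i) u), ← mul_pow]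
    exact pow_le_pow_left₀ (abs_nonneg _) (hα i) 2
  rcases (norm_nonneg w).eq_or_lt with h0 | h0
  · rw [← h0]; positivity
  · refine le_of_sq_le_sq ?_ (by positivity)
    refine le_of_mul_le_mul_right ?_ (pow_pos h0 2)
    nlinarith [h2]

/-- The constant involves `c` and not the number of terms, so the smoothness of the chain does not
deteriorate with its length. -/
theorem norm_ridgeGradient_sub_le (hc : 0 ≤ c)
    (ha : ∀ u, ∑ i ∈ Finset.range N, (inner ℝ (a i) u) ^ 2 ≤ c * ‖u‖ ^ 2)
    {D : ℝ} (hD : 0 ≤ D) (hψ' : ∀ y z, |ψ' y - ψ' z| ≤ D * |y - z|) (x y : E d) :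
    ‖ridgeGradient ψ' a N x - ridgeGradient ψ' a N y‖ ≤ D * c * ‖x - y‖ := by
  rw [ridgeGradient, ridgeGradient, ← Finset.sum_sub_distrib]
  simp only [← sub_smul]
  refine norm_sum_smul_le hc ha hD fun i => ?_
  rw [inner_sub_right]
  exact hψ' _ _

/-- Applied to `u`, the difference has coefficients at most `L |⟨a i, x - y⟩| |⟨a i, u⟩|`;
Cauchy–Schwarz on the first inner product costs the extra factor `b`. -/
theorem norm_ridgeHessian_sub_le (hc : 0 ≤ c)
    (ha : ∀ u, ∑ i ∈ Finset.range N, (inner ℝ (a i) u) ^ 2 ≤ c * ‖u‖ ^ 2)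
    {b : ℝ} (hb : ∀ i, ‖a i‖ ≤ b)
    {L : ℝ} (hL : 0 ≤ L) (hψ'' : ∀ y z, |ψ'' y - ψ'' z| ≤ L * |y - z|) (x y : E d) :
    ‖ridgeHessian ψ'' a N x - ridgeHessian ψ'' a N y‖ ≤ L * b * c * ‖x - y‖ := by
  have hb0 : 0 ≤ b := (norm_nonneg _).trans (hb 0)
  refine ContinuousLinearMap.opNorm_le_bound _ (by positivity) fun u => ?_
  rw [sub_apply, ridgeHessian_apply, ridgeHessian_apply,
    ← Finset.sum_sub_distrib]
  simp only [← sub_smul, ← sub_mul]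
  rw [show L * b * c * ‖x - y‖ * ‖u‖ = (L * (b * ‖x - y‖)) * c * ‖u‖ by ring]
  refine norm_sum_smul_le hc ha (by positivity) fun i => ?_
  rw [abs_mul]
  refine mul_le_mul_of_nonneg_right ((hψ'' _ _).trans ?_) (abs_nonneg _)
  rw [← inner_sub_right]
  exact mul_le_mul_of_nonneg_left ((abs_real_inner_le_norm _ _).trans
    (mul_le_mul_of_nonneg_right (hb i) (norm_nonneg _))) hL

theorem norm_ridgeHessian_le (hc : 0 ≤ c)
    (ha : ∀ u, ∑ i ∈ Finset.range N, (inner ℝ (a i) u) ^ 2 ≤ c * ‖u‖ ^ 2)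
    {D : ℝ} (hD : 0 ≤ D) (hψ'' : ∀ z, |ψ'' z| ≤ D) (x : E d) :
    ‖ridgeHessian ψ'' a N x‖ ≤ D * c := by
  refine ContinuousLinearMap.opNorm_le_bound _ (by positivity) fun u => ?_
  rw [ridgeHessian_apply]
  refine norm_sum_smul_le hc ha hD fun i => ?_
  rw [abs_mul]
  exact mul_le_mul_of_nonneg_right (hψ'' _) (abs_nonneg _)

theorem convexOn_ridgeSum (hψ : ConvexOn ℝ univ ψ) : ConvexOn ℝ univ (ridgeSum ψ a N) := by
  refine convexOn_iff_forall_pos.2 ⟨convex_univ, fun x _ y _ s t hs ht hst => ?_⟩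
  simp only [ridgeSum, smul_eq_mul, Finset.mul_sum, ← Finset.sum_add_distrib]
  refine Finset.sum_le_sum fun i _ => ?_
  rw [inner_add_right, inner_smul_right, inner_smul_right]
  exact hψ.2 (mem_univ _) (mem_univ _) hs.le ht.le hst

theorem contDiff_ridgeSum (hψ : ContDiff ℝ 2 ψ) : ContDiff ℝ 2 (ridgeSum ψ a N) :=
  ContDiff.sum fun i _ => hψ.comp (innerSL ℝ (a i)).contDiff

end Ridge

/-! ### The profile of the chain -/

/-- A convex profile with minimizer `π`. For `κ = 0` it is quadratic; for `κ = 1` its second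
derivative `sin²` vanishes at `0`. -/
def profile (κ z : ℝ) : ℝ := ((z - Real.pi) ^ 2 - κ * Real.sin z ^ 2) / 4

/-- The derivative of `profile κ`. -/
def profile' (κ z : ℝ) : ℝ := (z - Real.pi) / 2 - κ * Real.sin (2 * z) / 4

/-- The second derivative of `profile κ`. -/
def profile'' (κ z : ℝ) : ℝ := 1 / 2 - κ * Real.cos (2 * z) / 2

theorem hasDerivAt_profile (κ z : ℝ) : HasDerivAt (profile κ) (profile' κ z) z := by
  have h := (((hasDerivAt_id z).sub_const Real.pi).pow 2).sub
    (((Real.hasDerivAt_sin z).pow 2).const_mul κ) |>.div_const 4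
  refine h.congr_deriv ?_
  simp only [profile', Real.sin_two_mul, id]
  push_cast
  ring

theorem hasDerivAt_profile' (κ z : ℝ) : HasDerivAt (profile' κ) (profile'' κ z) z := by
  have h := (((hasDerivAt_id z).sub_const Real.pi).div_const 2).sub
    ((((hasDerivAt_id z).const_mul 2).sin.const_mul κ).div_const 4)
  refine h.congr_deriv ?_
  simp only [profile'', id]
  ring

theorem contDiff_profile (κ : ℝ) : ContDiff ℝ 2 (profile κ) :=
  (((contDiff_id.sub contDiff_const).pow 2).sub
    (contDiff_const.mul (Real.contDiff_sin.pow 2))).div_const 4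

theorem continuous_profile'' (κ : ℝ) : Continuous (profile'' κ) := by
  unfold profile''
  fun_prop

theorem profile_zero (κ : ℝ) : profile κ 0 = Real.pi ^ 2 / 4 := by simp [profile]

theorem profile_pi (κ : ℝ) : profile κ Real.pi = 0 := by simp [profile]

theorem profile''_one_zero : profile'' 1 0 = 0 := by simp [profile'']

variable {κ : ℝ}

/-- The sine is 1-Lipschitz and vanishes at `π`, so `sin² z ≤ (z - π)²`. -/
theorem profile_nonneg (h1 : κ ≤ 1) (z : ℝ) : 0 ≤ profile κ z := by
  have h : Real.sin z ^ 2 ≤ (z - Real.pi) ^ 2 := by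
    have h2 := Real.abs_sin_sub_sin_le z Real.pi
    rw [Real.sin_pi, sub_zero] at h2
    exact sq_le_sq.2 h2
  unfold profile
  nlinarith [sq_nonneg (Real.sin z)]

theorem abs_profile'_sub_le (h0 : 0 ≤ κ) (h1 : κ ≤ 1) (y z : ℝ) :
    |profile' κ y - profile' κ z| ≤ 1 * |y - z| := by
  have h := Real.abs_sin_sub_sin_le (2 * y) (2 * z)
  rw [← mul_sub, abs_mul, abs_two] at h
  rw [show profile' κ y - profile' κ z =
    (y - z) / 2 - κ * (Real.sin (2 * y) - Real.sin (2 * z)) / 4 by unfold profile'; ring]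
  refine (abs_sub _ _).trans ?_
  rw [abs_div, abs_div, abs_mul, abs_of_nonneg h0, abs_two, abs_of_pos (zero_lt_four' ℝ)]
  nlinarith [abs_nonneg (y - z), abs_nonneg (Real.sin (2 * y) - Real.sin (2 * z))]

/-- Since `z ↦ sin (2z)` is 2-Lipschitz, the term `κ sin (2z) / 4` varies with slope at most `1 /
2`, which the linear part absorbs. -/
theorem monotone_profile' (h0 : 0 ≤ κ) (h1 : κ ≤ 1) : Monotone (profile' κ) := by
  intro y z hyz
  have h := Real.abs_sin_sub_sin_le (2 * z) (2 * y)
  rw [abs_of_nonneg (by linarith : 0 ≤ 2 * z - 2 * y)] at h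
  have h2 := (abs_le.1 h).2
  unfold profile'
  nlinarith

theorem convexOn_profile (h0 : 0 ≤ κ) (h1 : κ ≤ 1) : ConvexOn ℝ univ (profile κ) := by
  refine Monotone.convexOn_univ_of_deriv (fun z => (hasDerivAt_profile κ z).differentiableAt) ?_
  rw [show deriv (profile κ) = profile' κ from funext fun z => (hasDerivAt_profile κ z).deriv]
  exact monotone_profile' h0 h1

theorem abs_profile''_sub_le (h0 : 0 ≤ κ) (y z : ℝ) :
    |profile'' κ y - profile'' κ z| ≤ κ * |y - z| := by
  have h := Real.abs_cos_sub_cos_le (2 * y) (2 * z)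
  rw [← mul_sub, abs_mul, abs_two] at h
  rw [show profile'' κ y - profile'' κ z =
    -(κ * (Real.cos (2 * y) - Real.cos (2 * z)) / 2) by unfold profile''; ring]
  rw [abs_neg, abs_div, abs_mul, abs_of_nonneg h0, abs_two]
  nlinarith

theorem abs_profile''_le (h0 : 0 ≤ κ) (h1 : κ ≤ 1) (z : ℝ) : |profile'' κ z| ≤ 1 := by
  unfold profile''
  rw [abs_le]
  constructor <;> nlinarith [Real.neg_one_le_cos (2 * z), Real.cos_le_one (2 * z)]

/-! ### The chain -/

/-- The differences `v i - v (i + 1)`. -/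
def link {d : ℕ} (v : ℕ → E d) (i : ℕ) : E d := v i - v (i + 1)

/-- The worst-case function attached to a frame. -/
def chain {d : ℕ} (κ : ℝ) (N : ℕ) (v : ℕ → E d) : E d → ℝ := ridgeSum (profile κ) (link v) N

/-- The minimizer of the chain. -/
def chainMinimizer {d : ℕ} (N : ℕ) (v : ℕ → E d) : E d :=
  ∑ j ∈ Finset.range N, (Real.pi * (N - j)) • v j

theorem sum_link {d : ℕ} {v : ℕ → E d} {N : ℕ} (hN : v N = 0) :
    ∑ i ∈ Finset.range N, link v i = v 0 := by
  simp only [link, Finset.sum_range_sub', hN, sub_zero]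

/-- The gradient of the chain at a point orthogonal to `v t, v (t + 1), …` depends only on
`v 0, …, v t`. -/
theorem ridgeGradient_link_congr {d : ℕ} (ψ' : ℝ → ℝ) {N t : ℕ} {v w : ℕ → E d} {x : E d}
    (hv : v N = 0) (hw : w N = 0) (hvw : ∀ j ≤ t, v j = w j)
    (hvx : ∀ j, t ≤ j → inner ℝ (v j) x = 0) (hwx : ∀ j, t ≤ j → inner ℝ (w j) x = 0) :
    ridgeGradient ψ' (link v) N x = ridgeGradient ψ' (link w) N x := by
  -- Unseen links contribute `ψ' 0`, which need not vanish. Splitting this constant off every term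
  -- makes it telescope to `ψ' 0 • u 0`; the remaining coefficients are zero for `i ≥ t`.
  have key : ∀ u : ℕ → E d, u N = 0 → ridgeGradient ψ' (link u) N x =
      ∑ i ∈ Finset.range N, (ψ' (inner ℝ (link u i) x) - ψ' 0) • link u i + ψ' 0 • u 0 := by
    intro u hu
    rw [ridgeGradient, ← sum_link hu, Finset.smul_sum, ← Finset.sum_add_distrib]
    simp [sub_smul]
  rw [key v hv, key w hw, hvw 0 t.zero_le]
  congr 1
  refine Finset.sum_congr rfl fun i _ => ?_
  rcases lt_or_ge i t with hi | hi
  · simp only [link, hvw i hi.le, hvw (i + 1) hi]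
  · simp [link, inner_sub_left, hvx i hi, hvx (i + 1) (by omega), hwx i hi, hwx (i + 1) (by omega)]

/-- If `ψ''` vanishes at `0`, the Hessian of the chain at a point orthogonal to
`v t, v (t + 1), …` depends only on `v 0, …, v t`. -/
theorem ridgeHessian_link_congr {d : ℕ} {ψ'' : ℝ → ℝ} (h0 : ψ'' 0 = 0) {N t : ℕ} {v w : ℕ → E d}
    {x : E d} (hvw : ∀ j ≤ t, v j = w j)
    (hvx : ∀ j, t ≤ j → inner ℝ (v j) x = 0) (hwx : ∀ j, t ≤ j → inner ℝ (w j) x = 0) :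
    ridgeHessian ψ'' (link v) N x = ridgeHessian ψ'' (link w) N x := by
  refine Finset.sum_congr rfl fun i _ => ?_
  rcases lt_or_ge i t with hi | hi
  · simp only [link, hvw i hi.le, hvw (i + 1) hi]
  · simp [link, inner_sub_left, hvx i hi, hvx (i + 1) (by omega), hwx i hi, hwx (i + 1) (by omega),
      h0]

namespace IsFrame

variable {d N : ℕ} {v : ℕ → E d}

/-- Bessel's inequality is used twice, for `v i` and for the shifted `v (i + 1)`, with `(a - b)² ≤
2a² + 2b²`. -/
theorem sum_inner_link_sq_le (hv : IsFrame v N) (u : E d) :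
    ∑ i ∈ Finset.range N, (inner ℝ (link v i) u) ^ 2 ≤ 4 * ‖u‖ ^ 2 := by
  have h1 := hv.sum_inner_sq_le u
  have h2 : ∑ i ∈ Finset.range N, (inner ℝ (v (i + 1)) u) ^ 2 ≤ ‖u‖ ^ 2 := by
    have h3 := Finset.sum_range_succ' (fun i => (inner ℝ (v i) u) ^ 2) N
    rw [Finset.sum_range_succ, hv.eq_zero le_rfl, inner_zero_left] at h3
    nlinarith [sq_nonneg (inner ℝ (v 0) u)]
  calc ∑ i ∈ Finset.range N, (inner ℝ (link v i) u) ^ 2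
      ≤ ∑ i ∈ Finset.range N, (2 * (inner ℝ (v i) u) ^ 2 + 2 * (inner ℝ (v (i + 1)) u) ^ 2) := by
        refine Finset.sum_le_sum fun i _ => ?_
        rw [link, inner_sub_left]
        nlinarith [sq_nonneg (inner ℝ (v i) u + inner ℝ (v (i + 1)) u)]
    _ ≤ 4 * ‖u‖ ^ 2 := by
        rw [Finset.sum_add_distrib, ← Finset.mul_sum, ← Finset.mul_sum]
        linarith

theorem norm_le_one (hv : IsFrame v N) (i : ℕ) : ‖v i‖ ≤ 1 := by
  have h := hv i i
  rw [real_inner_self_eq_norm_sq] at h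
  refine le_of_sq_le_sq ?_ zero_le_one
  rw [h]
  split_ifs <;> norm_num

theorem norm_link_le (hv : IsFrame v N) (i : ℕ) : ‖link v i‖ ≤ 2 :=
  (norm_sub_le _ _).trans (by linarith [hv.norm_le_one i, hv.norm_le_one (i + 1)])

theorem inner_chainMinimizer (hv : IsFrame v N) {i : ℕ} (hi : i ≤ N) :
    inner ℝ (v i) (chainMinimizer N v) = Real.pi * (N - i) := by
  rw [chainMinimizer, inner_sum]
  simp only [inner_smul_right, hv i]
  -- The case `i = N`, where both sides are zero, is needed for the last link.
  rcases hi.eq_or_lt with rfl | hi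
  · simp
  · simp [hi]

/-- The coordinates of the minimizer drop by `π` at each index, down to `0` at `N`, so every link
sits at the minimum of the profile. -/
theorem inner_link_chainMinimizer (hv : IsFrame v N) {i : ℕ} (hi : i < N) :
    inner ℝ (link v i) (chainMinimizer N v) = Real.pi := by
  rw [link, inner_sub_left, hv.inner_chainMinimizer hi.le, hv.inner_chainMinimizer hi]
  push_cast
  ring

theorem chain_chainMinimizer (hv : IsFrame v N) : chain κ N v (chainMinimizer N v) = 0 := by
  unfold chain ridgeSum
  exact Finset.sum_eq_zero fun i hi => by
    rw [hv.inner_link_chainMinimizer (Finset.mem_range.1 hi), profile_pi]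

theorem norm_chainMinimizer_sq (hv : IsFrame v N) :
    ‖chainMinimizer N v‖ ^ 2 = ∑ j ∈ Finset.range N, (Real.pi * ((N : ℝ) - j)) ^ 2 := by
  rw [← real_inner_self_eq_norm_sq]
  nth_rewrite 1 [chainMinimizer]
  rw [sum_inner]
  refine Finset.sum_congr rfl fun j hj => ?_
  rw [inner_smul_left, hv.inner_chainMinimizer (Finset.mem_range.1 hj).le]
  simp [sq]

/-- The constants are `1 · 4` for the gradient and `κ · 2 · 4` for the Hessian: the Lipschitz
constant of `ψ'` or `ψ''`, the link length in the latter, and the Bessel constant. For `κ = 0` any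
`L₂ ≥ 0` is allowed. -/
theorem isSmoothConvex_chain (hv : IsFrame v N) (h0 : 0 ≤ κ) (h1 : κ ≤ 1) {L₂ : ℝ}
    (hL₂ : 8 * κ ≤ L₂) : IsSmoothConvex (chain κ N v) 4 L₂ where
  convex := convexOn_ridgeSum (convexOn_profile h0 h1)
  contDiff := contDiff_ridgeSum (contDiff_profile κ)
  lipschitz_gradient x y := by
    rw [chain, gradient_ridgeSum _ _ (hasDerivAt_profile κ)]
    simpa using norm_ridgeGradient_sub_le zero_le_four hv.sum_inner_link_sq_le zero_le_one
      (abs_profile'_sub_le h0 h1) x y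
  lipschitz_hessian x y := by
    rw [chain, hessian_ridgeSum _ _ (hasDerivAt_profile κ) (hasDerivAt_profile' κ)]
    refine (norm_ridgeHessian_sub_le zero_le_four hv.sum_inner_link_sq_le hv.norm_link_le h0
      (abs_profile''_sub_le h0) x y).trans (mul_le_mul_of_nonneg_right ?_ (norm_nonneg _))
    linarith

end IsFrame

theorem chain_nonneg {d N : ℕ} (v : ℕ → E d) (h1 : κ ≤ 1) (x : E d) :
    0 ≤ chain κ N v x := by
  unfold chain ridgeSum
  exact Finset.sum_nonneg fun _ _ => profile_nonneg h1 _

/-- Each link of index at least `t` still contributes `ψ 0 = π² / 4`, and the others are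
nonnegative. -/
theorem le_chain_of_orthogonal {d N t : ℕ} {v : ℕ → E d} (h1 : κ ≤ 1) {x : E d}
    (ht : t ≤ N) (hx : ∀ j, t ≤ j → inner ℝ (v j) x = 0) :
    ((N : ℝ) - t) * (Real.pi ^ 2 / 4) ≤ chain κ N v x := by
  obtain ⟨n, rfl⟩ := Nat.exists_eq_add_of_le ht
  rw [chain, ridgeSum, Finset.sum_range_add]
  have h2 : ∑ i ∈ Finset.range n, profile κ (inner ℝ (link v (t + i)) x) =
      n * (Real.pi ^ 2 / 4) := by
    rw [Finset.sum_congr rfl fun i _ => by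
      rw [link, inner_sub_left, hx (t + i) (by omega), hx (t + i + 1) (by omega), sub_zero,
        profile_zero]]
    simp
  have h3 := chain_nonneg (N := t) v h1 x
  rw [chain, ridgeSum] at h3
  rw [h2]
  push_cast
  linarith

/-- The distance from the origin to the minimizer of the chain of length `2 * T`. -/
def chainRadius (T : ℕ) : ℝ :=
  Real.sqrt (∑ j ∈ Finset.range (2 * T), (Real.pi * (((2 * T : ℕ) : ℝ) - j)) ^ 2)

/-- There are `2T` terms, each at most `10 (2T)²`; thus `R` is of order `T^(3/2)`. -/
theorem chainRadius_sq_le (T : ℕ) : chainRadius T ^ 2 ≤ 81 * (T : ℝ) ^ 3 := by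
  rw [chainRadius, Real.sq_sqrt (Finset.sum_nonneg fun _ _ => sq_nonneg _)]
  have h : ∀ j ∈ Finset.range (2 * T),
      (Real.pi * (((2 * T : ℕ) : ℝ) - j)) ^ 2 ≤ 10 * (2 * T : ℝ) ^ 2 := by
    intro j hj
    have hj' : (j : ℝ) ≤ ((2 * T : ℕ) : ℝ) := by exact_mod_cast (Finset.mem_range.1 hj).le
    have h1 : (((2 * T : ℕ) : ℝ) - j) ^ 2 ≤ (2 * T : ℝ) ^ 2 :=
      pow_le_pow_left₀ (by linarith) (by push_cast; linarith [j.cast_nonneg (α := ℝ)]) 2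
    have h2 : Real.pi ^ 2 ≤ 10 := by nlinarith [Real.pi_lt_d2, Real.pi_pos]
    rw [mul_pow]
    exact mul_le_mul h2 h1 (sq_nonneg _) (by norm_num)
  refine (Finset.sum_le_card_nsmul _ _ _ h).trans ?_
  rw [Finset.card_range, nsmul_eq_mul]
  push_cast
  nlinarith [pow_nonneg (T.cast_nonneg (α := ℝ)) 3]

theorem chainRadius_pos {T : ℕ} (hT : 1 ≤ T) : 0 < chainRadius T := by
  refine Real.sqrt_pos.2 (Finset.sum_pos (fun j hj => ?_) ⟨0, by simp; omega⟩)
  have : (j : ℝ) < ((2 * T : ℕ) : ℝ) := by exact_mod_cast Finset.mem_range.1 hj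
  have := Real.pi_pos
  exact pow_pos (mul_pos this (by linarith)) 2

/-! ### Lower bounds from the chain -/

section ChainBound

variable {M : MethodFamily} {C : ℝ} {Ξ₁ Ξ₂ Ξ₃ : ℕ → ℝ} {T : ℕ}

/-- No method beats the chain of length `2 * T` if the Hessian estimates do not reveal more of the
frame than the gradients do. -/
theorem chain_gap_le_rate
    (h : EnsuresRateStochasticHessian M C Ξ₁ Ξ₂ Ξ₃ ∨ EnsuresRateInexactHessian M C Ξ₁ Ξ₂ Ξ₃)
    (hT : 1 ≤ T) {κ : ℝ} (h0 : 0 ≤ κ) (h1 : κ ≤ 1) (p : Params) (hL₁ : p.L₁ = 4)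
    (hL₂ : 8 * κ ≤ p.L₂) (hR : p.R = chainRadius T)
    (H : (ℕ → E (4 * T)) → E (4 * T) → Op (4 * T)) (hHm : ∀ v, Measurable (H v))
    (hHs : ∀ v x, (H v x).IsSymmetric)
    (hH : ∀ v, IsFrame v (2 * T) → ∀ x,
      ‖H v x - ridgeHessian (profile'' κ) (link v) (2 * T) x‖ ≤ p.σ₂)
    (hHcongr : ∀ v w x t, (∀ j ≤ t, v j = w j) →
      (∀ j, t ≤ j → inner ℝ (v j) x = 0) → (∀ j, t ≤ j → inner ℝ (w j) x = 0) → H v x = H w x) :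
    2 * (T : ℝ) ≤ C * rate Ξ₁ Ξ₂ Ξ₃ p T := by
  obtain ⟨v, hv, hvx⟩ := (M T p (4 * T)).exists_resisting_frame 0
    (fun v x => (ridgeGradient (profile' κ) (link v) (2 * T) x, H v x)) (2 * T) (by omega)
    fun v w x t hv hw hvw hvx hwx => Prod.ext
      (ridgeGradient_link_congr _ hv hw hvw hvx hwx) (hHcongr v w x t hvw hvx hwx)
  have hgrad : gradient (chain κ (2 * T) v) = ridgeGradient (profile' κ) (link v) (2 * T) :=
    gradient_ridgeSum _ _ (hasDerivAt_profile κ)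
  have hhess : hessian (chain κ (2 * T) v) = ridgeHessian (profile'' κ) (link v) (2 * T) :=
    hessian_ridgeSum _ _ (hasDerivAt_profile κ) (hasDerivAt_profile' κ)
  have hcont : Continuous (ridgeGradient (profile' κ) (link v) (2 * T)) := by
    have : Continuous (profile' κ) :=
      continuous_iff_continuousAt.2 fun z => (hasDerivAt_profile' κ z).continuousAt
    unfold ridgeGradient
    fun_prop
  have hgap := minExpectedGapLE_of_ensuresRate h hT p (f := chain κ (2 * T) v)
    (hL₁ ▸ hv.isSmoothConvex_chain h0 h1 hL₂) (x₀ := 0) (xstar := chainMinimizer (2 * T) v)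
    (fun x _ => by
      rw [mem_ofPred_eq, hv.chain_chainMinimizer]
      exact chain_nonneg v h1 x)
    (by
      rw [zero_sub, norm_neg, hR, chainRadius, ← hv.norm_chainMinimizer_sq,
        Real.sqrt_sq (norm_nonneg _)])
    (Measure.dirac ())
    (isStochasticGradient_exact (fun x => congrFun hgrad x) hcont (Measure.dirac ()) p.σ₁)
    (hHm v) (hHs v) (fun x => hhess ▸ hH v hv x)
  obtain ⟨t, ht, hle⟩ := exists_gap_le_of_minExpectedGapLE hgap
  rw [hv.chain_chainMinimizer, sub_zero] at hle
  have hlow := le_chain_of_orthogonal (N := 2 * T) h1 (by omega) (hvx t)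
  refine le_trans ?_ (hlow.trans hle)
  have ht' : (t : ℝ) ≤ T := by exact_mod_cast ht
  -- At least `2T - T = T` links are untouched, each worth `π² / 4 ≥ 9 / 4 > 2`.
  have hpi : 9 ≤ Real.pi ^ 2 := by nlinarith [Real.pi_gt_three]
  push_cast
  nlinarith

theorem rate_le_of_le {p : Params} {B : ℝ} (h₁ : p.σ₁ * p.R / Ξ₁ T ≤ B)
    (h₂ : p.σ₂ * p.R ^ 2 / Ξ₂ T ≤ B) (h₃ : p.L₂ * p.R ^ 3 / Ξ₃ T ≤ B) :
    rate Ξ₁ Ξ₂ Ξ₃ p T ≤ B :=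
  max_le h₁ (max_le h₂ h₃)

/-- The bound for exact second-order information. -/
theorem third_rate_le
    (h : EnsuresRateStochasticHessian M C Ξ₁ Ξ₂ Ξ₃ ∨ EnsuresRateInexactHessian M C Ξ₁ Ξ₂ Ξ₃)
    (hC : 0 < C) (hT : 1 ≤ T) (hΞ₁ : 0 < Ξ₁ T) (hΞ₂ : 0 < Ξ₂ T) (hΞ₃ : 0 < Ξ₃ T) :
    Ξ₃ T ≤ 2916 * C * ((T : ℝ) ^ 3 * Real.sqrt T) := by
  have hr := chainRadius_pos hT
  have hr2 := chainRadius_sq_le T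
  set r := chainRadius T
  have hT0 : (0 : ℝ) < T := by exact_mod_cast hT
  -- `σ₁` and `σ₂` are set so that the first two terms of the rate equal the third; the oracle used
  -- is exact and admits any noise level.
  let p : Params :=
    { L₁ := 4, L₂ := 8, σ₁ := Ξ₁ T * (8 * r ^ 2) / Ξ₃ T, σ₂ := Ξ₂ T * (8 * r) / Ξ₃ T, R := r
      L₁_pos := by norm_num
      L₂_pos := by norm_num
      σ₁_pos := by positivity
      σ₂_pos := by positivity }
  have hgap := chain_gap_le_rate h hT zero_le_one le_rfl p rfl (by norm_num [p]) rfl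
    (fun v => ridgeHessian (profile'' 1) (link v) (2 * T))
    (fun v => by
      have := continuous_profile'' 1
      refine Continuous.measurable ?_
      unfold ridgeHessian
      fun_prop)
    (fun v x => ridgeHessian_isSymmetric _ _ x)
    (fun v _ x => by rw [sub_self, norm_zero]; exact p.σ₂_pos.le)
    (fun v w x t hvw hvx hwx => ridgeHessian_link_congr profile''_one_zero hvw hvx hwx)
  have hrate : rate Ξ₁ Ξ₂ Ξ₃ p T ≤ 8 * r ^ 3 / Ξ₃ T := by
    refine rate_le_of_le ?_ ?_ le_rfl
    · exact le_of_eq (by simp only [p]; field_simp)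
    · exact le_of_eq (by simp only [p]; field_simp)
  have h2 := hgap.trans (mul_le_mul_of_nonneg_left hrate hC.le)
  rw [← mul_div_assoc, le_div_iff₀ hΞ₃] at h2
  have hs := Real.sqrt_nonneg (T : ℝ)
  have hs2 := Real.sq_sqrt hT0.le
  set q := Real.sqrt (T : ℝ)
  -- With `r³ ≤ 729 T^(9/2)`, the inequality `2T Ξ₃ ≤ 8 C r³` yields `2916 = 8 · 729 / 2`.
  have hrle : r ≤ 9 * (T * q) := by
    refine le_of_sq_le_sq ?_ (by positivity)
    calc r ^ 2 ≤ 81 * (T : ℝ) ^ 3 := hr2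
      _ = (9 * (T * q)) ^ 2 := by rw [mul_pow, mul_pow, hs2]; ring
  have hr3 : r ^ 3 ≤ 729 * ((T : ℝ) ^ 4 * q) := by
    calc r ^ 3 ≤ (9 * (T * q)) ^ 3 := pow_le_pow_left₀ hr.le hrle 3
      _ = 729 * ((T : ℝ) ^ 3 * (q ^ 2 * q)) := by ring
      _ = 729 * ((T : ℝ) ^ 4 * q) := by rw [hs2]; ring
  have h3 := mul_le_mul_of_nonneg_left hr3 hC.le
  refine le_of_mul_le_mul_left ?_ (mul_pos two_pos hT0)
  linarith

/-- The bound for Hessians that carry no information. -/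
theorem second_rate_le
    (h : EnsuresRateStochasticHessian M C Ξ₁ Ξ₂ Ξ₃ ∨ EnsuresRateInexactHessian M C Ξ₁ Ξ₂ Ξ₃)
    (hC : 0 < C) (hT : 1 ≤ T) (hΞ₁ : 0 < Ξ₁ T) (hΞ₂ : 0 < Ξ₂ T) (hΞ₃ : 0 < Ξ₃ T) :
    Ξ₂ T ≤ 162 * C * (T : ℝ) ^ 2 := by
  have hr := chainRadius_pos hT
  have hr2 := chainRadius_sq_le T
  set r := chainRadius T
  have hT0 : (0 : ℝ) < T := by exact_mod_cast hT
  -- The quadratic chain leaves `L₂` free to balance the rate, as is `σ₁`. The value `σ₂ = 4` bounds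
  -- its Hessian, so answering `0` is legitimate.
  let p : Params :=
    { L₁ := 4, L₂ := Ξ₃ T * 4 / (Ξ₂ T * r), σ₁ := Ξ₁ T * (4 * r) / Ξ₂ T, σ₂ := 4, R := r
      L₁_pos := by norm_num
      L₂_pos := by positivity
      σ₁_pos := by positivity
      σ₂_pos := by norm_num }
  have hgap := chain_gap_le_rate h hT le_rfl zero_le_one p rfl (by simpa using p.L₂_pos.le) rfl
    (fun _ _ => 0) (fun _ => measurable_const) (fun _ _ _ _ => by simp)
    (fun v hv x => by
      rw [zero_sub, norm_neg]
      simpa using norm_ridgeHessian_le zero_le_four hv.sum_inner_link_sq_le zero_le_one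
        (abs_profile''_le le_rfl zero_le_one) x)
    (fun _ _ _ _ _ _ _ => rfl)
  have hrate : rate Ξ₁ Ξ₂ Ξ₃ p T ≤ 4 * r ^ 2 / Ξ₂ T := by
    refine rate_le_of_le ?_ le_rfl ?_
    · exact le_of_eq (by simp only [p]; field_simp)
    · exact le_of_eq (by simp only [p]; field_simp)
  have h2 := hgap.trans (mul_le_mul_of_nonneg_left hrate hC.le)
  rw [← mul_div_assoc, le_div_iff₀ hΞ₂] at h2
  have h3 := mul_le_mul_of_nonneg_left hr2 hC.le
  refine le_of_mul_le_mul_left ?_ (mul_pos two_pos hT0)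
  linarith

end ChainBound

/-! ### Lower bound from rarely informative gradients -/

/-- The law of a coin that shows `true` with probability `q`. -/
def coin (q : ℝ) : Measure Bool :=
  ENNReal.ofReal q • Measure.dirac true + ENNReal.ofReal (1 - q) • Measure.dirac false

theorem coin_false (q : ℝ) : coin q {false} = ENNReal.ofReal (1 - q) := by simp [coin]

theorem isProbabilityMeasure_coin {q : ℝ} (h0 : 0 ≤ q) (h1 : q ≤ 1) :
    IsProbabilityMeasure (coin q) :=
  ⟨by simp [coin, ← ENNReal.ofReal_add h0 (sub_nonneg.2 h1)]⟩

theorem integral_coin {F : Type*} [NormedAddCommGroup F] [NormedSpace ℝ F] [CompleteSpace F]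
    {q : ℝ} (h0 : 0 ≤ q) (h1 : q ≤ 1) (φ : Bool → F) :
    ∫ b, φ b ∂(coin q) = q • φ true + (1 - q) • φ false := by
  rw [coin, integral_add_measure, integral_smul_measure, integral_smul_measure, integral_dirac,
    integral_dirac, ENNReal.toReal_ofReal h0, ENNReal.toReal_ofReal (sub_nonneg.2 h1)]
  · exact (integrable_dirac (by simp)).smul_measure ENNReal.ofReal_ne_top
  · exact (integrable_dirac (by simp)).smul_measure ENNReal.ofReal_ne_top

/-- In `T` tosses of a coin that shows `true` with probability at most `1 / (2 * T)`, no `true`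
occurs with probability at least one half. -/
theorem half_le_infinitePi_coin {T : ℕ} {q : ℝ} (h0 : 0 ≤ q) (h1 : q ≤ 1) (hq : T * q ≤ 1 / 2) :
    haveI := isProbabilityMeasure_coin h0 h1
    1 / 2 ≤ (Measure.infinitePi fun _ : ℕ => coin q).real {ξ | ∀ i < T, ξ i = false} := by
  have := isProbabilityMeasure_coin h0 h1
  have hset : {ξ : ℕ → Bool | ∀ i < T, ξ i = false} =
      Set.pi (Finset.range T : Set ℕ) fun _ => {false} := by
    ext ξ
    simp [Set.mem_pi]
  simp only [measureReal_def, hset]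
  rw [Measure.infinitePi_pi _ fun _ _ => MeasurableSet.of_discrete]
  simp only [coin_false, Finset.prod_const, Finset.card_range, ENNReal.toReal_pow,
    ENNReal.toReal_ofReal (sub_nonneg.2 h1)]
  -- Bernoulli's inequality: `(1 - q)^T ≥ 1 - T q ≥ 1 / 2`.
  have := one_add_mul_le_pow (a := -q) (by linarith) T
  rw [← sub_eq_add_neg] at this
  linarith

/-- Half the squared distance to `s`. -/
def halfSqDist {d : ℕ} (s : E d) (x : E d) : ℝ := ‖x - s‖ ^ 2 / 2

section HalfSqDist

variable {d : ℕ} (s : E d)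

theorem halfSqDist_self : halfSqDist s s = 0 := by simp [halfSqDist]

theorem halfSqDist_nonneg (x : E d) : 0 ≤ halfSqDist s x := by unfold halfSqDist; positivity

theorem gradient_halfSqDist : gradient (halfSqDist s) = fun x => x - s := by
  funext x
  refine HasGradientAt.gradient (hasGradientAt_iff_hasFDerivAt.2 ?_)
  have h1 : HasFDerivAt (halfSqDist s) _ x :=
    (((hasFDerivAt_id x).sub_const s).norm_sq).mul_const (2⁻¹ : ℝ)
  refine h1.congr_fderiv (ContinuousLinearMap.ext fun u => ?_)
  simp

theorem hessian_halfSqDist : hessian (halfSqDist s) = fun _ => ContinuousLinearMap.id ℝ (E d) := by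
  funext x
  rw [hessian, gradient_halfSqDist]
  exact ((hasFDerivAt_id x).sub_const s).fderiv

theorem isSmoothConvex_halfSqDist {L₂ : ℝ} (hL₂ : 0 ≤ L₂) :
    IsSmoothConvex (halfSqDist s) 1 L₂ where
  convex := by
    have h := (convexOn_univ_norm (E := E d)).pow (fun x _ => norm_nonneg x) 2
    refine ⟨convex_univ, fun x _ y _ a b ha hb hab => ?_⟩
    have h1 := h.2 (mem_univ (x - s)) (mem_univ (y - s)) ha hb hab
    have h2 : a • x + b • y - s = a • (x - s) + b • (y - s) := by
      have h3 : s = a • s + b • s := by rw [← add_smul, hab, one_smul]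
      nth_rewrite 1 [h3]
      module
    simp only [Pi.pow_apply, smul_eq_mul] at h1
    simp only [halfSqDist, h2, smul_eq_mul]
    linarith
  contDiff := ((contDiff_id.sub contDiff_const).norm_sq ℝ).div_const 2
  lipschitz_gradient x y := by simp [gradient_halfSqDist]
  lipschitz_hessian x y := by
    simp only [hessian_halfSqDist, sub_self, norm_zero]
    positivity

/-- An unbiased gradient of `halfSqDist s` that reveals `s` only with probability `c⁻¹`. -/
def rareGradient (c : ℝ) (x : E d) (b : Bool) : E d := x - (if b then c else 0) • s

/-- Scaling the rare signal by `c` restores the mean, and the variance is `c⁻¹ (c - 1)² + (1 - c⁻¹)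
= c - 1 ≤ c`. -/
theorem isStochasticGradient_rareGradient {c : ℝ} (hc : 1 ≤ c) (hs : ‖s‖ = 1) :
    IsStochasticGradient (halfSqDist s) (coin c⁻¹) (rareGradient s c) (Real.sqrt c) := by
  have hc0 : 0 < c := by linarith
  have h0 : 0 ≤ c⁻¹ := by positivity
  have h1 : c⁻¹ ≤ 1 := inv_le_one_of_one_le₀ hc
  have := isProbabilityMeasure_coin h0 h1
  refine ⟨?_, fun x => .of_finite, fun x => ?_, fun x => .of_finite, fun x => ?_⟩
  · exact measurable_fst.sub
      ((measurable_of_finite fun b : Bool => (if b then c else 0) • s).comp measurable_snd)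
  · rw [integral_coin h0 h1, gradient_halfSqDist]
    simp only [rareGradient, if_true, Bool.false_eq_true, if_false, zero_smul, sub_zero, smul_sub,
      smul_smul, inv_mul_cancel₀ hc0.ne']
    module
  · rw [integral_coin h0 h1, gradient_halfSqDist, Real.sq_sqrt hc0.le]
    have e1 : rareGradient s c x true - (x - s) = (1 - c) • s := by
      simp only [rareGradient, if_true]; module
    have e2 : rareGradient s c x false - (x - s) = s := by
      simp [rareGradient]
    simp only [e1, e2, norm_smul, hs, mul_one, Real.norm_eq_abs, sq_abs, smul_eq_mul, one_pow]
    rw [show c⁻¹ * (1 - c) ^ 2 + (1 - c⁻¹) = c - 1 by field_simp; ring]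
    linarith

end HalfSqDist

/-- The bound for stochastic gradients. -/
theorem first_rate_le {M : MethodFamily} {C : ℝ} {Ξ₁ Ξ₂ Ξ₃ : ℕ → ℝ} {T : ℕ}
    (h : EnsuresRateStochasticHessian M C Ξ₁ Ξ₂ Ξ₃ ∨ EnsuresRateInexactHessian M C Ξ₁ Ξ₂ Ξ₃)
    (hC : 0 < C) (hT : 1 ≤ T) (hΞ₁ : 0 < Ξ₁ T) (hΞ₂ : 0 < Ξ₂ T) (hΞ₃ : 0 < Ξ₃ T) :
    Ξ₁ T ≤ 8 * C * Real.sqrt T := by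
  have hT1 : (1 : ℝ) ≤ T := by exact_mod_cast hT
  set c : ℝ := 2 * T with hc_def
  have hc : 1 ≤ c := by linarith
  have hsc : 0 < Real.sqrt c := Real.sqrt_pos.2 (by linarith)
  let p : Params :=
    { L₁ := 1, L₂ := Ξ₃ T * Real.sqrt c / Ξ₁ T, σ₁ := Real.sqrt c
      σ₂ := Ξ₂ T * Real.sqrt c / Ξ₁ T, R := 1
      L₁_pos := by norm_num
      L₂_pos := by positivity
      σ₁_pos := hsc
      σ₂_pos := by positivity }
  let m := M T p (T + 2)
  -- These are the answers when the coin never shows `true`. They do not involve `s`, so `s` can be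
  -- chosen orthogonal to the `T + 1` points they generate in dimension `T + 2`.
  let null : E (T + 2) → Answer (T + 2) := fun x => (x, ContinuousLinearMap.id ℝ _)
  classical
  obtain ⟨s, hs, hs_orth⟩ := exists_unit_orthogonal ((Finset.range (T + 1)).image (m.point 0 null))
    (Finset.card_image_le.trans_lt (by simp))
  have h0 : 0 ≤ c⁻¹ := by positivity
  have h1 : c⁻¹ ≤ 1 := inv_le_one_of_one_le₀ hc
  have := isProbabilityMeasure_coin h0 h1
  obtain ⟨t, ht, hint, hle⟩ := minExpectedGapLE_of_ensuresRate h hT p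
    (isSmoothConvex_halfSqDist s p.L₂_pos.le) (x₀ := 0) (xstar := s)
    (fun x _ => (halfSqDist_self s).trans_le (halfSqDist_nonneg s x))
    (by rw [zero_sub, norm_neg, hs]) (coin c⁻¹) (isStochasticGradient_rareGradient s hc hs)
    (H := fun _ => ContinuousLinearMap.id ℝ _) measurable_const (fun _ _ _ => by simp)
    (fun x => by simpa [hessian_halfSqDist] using p.σ₂_pos.le)
  have hrate : rate Ξ₁ Ξ₂ Ξ₃ p T ≤ Real.sqrt c / Ξ₁ T := by
    refine rate_le_of_le ?_ ?_ ?_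
    · simp [p]
    · exact le_of_eq (by simp only [p]; field_simp)
    · exact le_of_eq (by simp only [p]; field_simp)
  let gap : (ℕ → Bool) → ℝ := fun ξ => halfSqDist s
    (m.iterate 0 (rareGradient s c) (fun _ _ => ContinuousLinearMap.id ℝ _) t ξ) - halfSqDist s s
  have hbig : {ξ : ℕ → Bool | ∀ i < T, ξ i = false} ⊆ {ξ | 1 / 2 ≤ gap ξ} := by
    intro ξ hξ
    have hrun : m.iterate 0 (rareGradient s c) (fun _ _ => ContinuousLinearMap.id ℝ _) t ξ =
        m.point 0 null t := by
      refine congrArg Prod.fst (m.run_congr 0 fun i hi => ?_)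
      simp [null, rareGradient, hξ i (by omega)]
    have horth := hs_orth _ (Finset.mem_image_of_mem (m.point 0 null)
      (Finset.mem_range.2 (Nat.lt_succ_of_le ht)))
    change 1 / 2 ≤ halfSqDist s _ - halfSqDist s s
    rw [hrun, halfSqDist, halfSqDist, sub_self, norm_zero, norm_sub_sq_real, real_inner_comm,
      horth, hs]
    nlinarith [sq_nonneg ‖m.point 0 null t‖]
  -- On the uninformative event the gap is `(‖x_t‖² + 1) / 2 ≥ 1 / 2`; Markov's inequality makes its
  -- mean at least `1 / 4`.
  have hmarkov : 1 / 2 * (Measure.infinitePi fun _ : ℕ => coin c⁻¹).real {ξ | 1 / 2 ≤ gap ξ} ≤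
      C * rate Ξ₁ Ξ₂ Ξ₃ p T :=
    (mul_meas_ge_le_integral_of_nonneg (.of_forall fun ξ =>
      sub_nonneg.2 ((halfSqDist_self s).trans_le (halfSqDist_nonneg s _))) hint (1 / 2)).trans hle
  have hprob := (half_le_infinitePi_coin (T := T) h0 h1
    (le_of_eq (by rw [hc_def]; field_simp))).trans (measureReal_mono hbig)
  have h2 : 1 / 4 ≤ C * (Real.sqrt c / Ξ₁ T) :=
    (by linarith [hprob, hmarkov] : (1 : ℝ) / 4 ≤ C * rate Ξ₁ Ξ₂ Ξ₃ p T).trans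
      (mul_le_mul_of_nonneg_left hrate hC.le)
  rw [← mul_div_assoc, le_div_iff₀ hΞ₁] at h2
  have h3 : Real.sqrt c ≤ 2 * Real.sqrt T := by
    rw [hc_def, Real.sqrt_mul zero_le_two]
    refine mul_le_mul_of_nonneg_right ?_ (Real.sqrt_nonneg _)
    rw [Real.sqrt_le_left] <;> norm_num
  nlinarith [mul_le_mul_of_nonneg_left h3 hC.le]

end SecondOrderLowerBound

end

theorem theorem2 :
    ∃ K : ℝ, 0 < K ∧
      ∀ (M : SecondOrderLowerBound.MethodFamily) (C : ℝ) (Ξ₁ Ξ₂ Ξ₃ : ℕ → ℝ), 0 < C →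
        (∀ T : ℕ, 1 ≤ T → 0 < Ξ₁ T ∧ 0 < Ξ₂ T ∧ 0 < Ξ₃ T) →
        (SecondOrderLowerBound.EnsuresRateStochasticHessian M C Ξ₁ Ξ₂ Ξ₃ ∨
          SecondOrderLowerBound.EnsuresRateInexactHessian M C Ξ₁ Ξ₂ Ξ₃) →
        ∀ T : ℕ, 1 ≤ T →
          Ξ₁ T ≤ K * C * Real.sqrt T ∧
          Ξ₂ T ≤ K * C * (T : ℝ) ^ 2 ∧
          Ξ₃ T ≤ K * C * (T : ℝ) ^ (7 / 2 : ℝ) := by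
  -- The largest of the three constants `8`, `162` and `2916`.
  refine ⟨2916, by norm_num, fun M C Ξ₁ Ξ₂ Ξ₃ hC hΞ h T hT => ?_⟩
  obtain ⟨h₁, h₂, h₃⟩ := hΞ T hT
  have hT0 : (0 : ℝ) < T := by exact_mod_cast hT
  refine ⟨?_, ?_, ?_⟩
  · refine (SecondOrderLowerBound.first_rate_le h hC hT h₁ h₂ h₃).trans ?_
    gcongr
    norm_num
  · refine (SecondOrderLowerBound.second_rate_le h hC hT h₁ h₂ h₃).trans ?_
    gcongr
    norm_num
  · have hpow : (T : ℝ) ^ (7 / 2 : ℝ) = (T : ℝ) ^ 3 * Real.sqrt T := by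
      rw [Real.sqrt_eq_rpow, ← Real.rpow_natCast, ← Real.rpow_add hT0]
      norm_num
    rw [hpow]
    exact SecondOrderLowerBound.third_rate_le h hC hT h₁ h₂ h₃
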